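/- For integers $b,c\ge 1$ and permutations $\sigma$ of $\{0,\dots,b-1\}$ and $\tau$ of $\{0,\dots,c-1\}$, let $\sigma\cdot\tau$ be the permutation of $\{0,\dots,bc-1\}$ with $(\sigma\cdot\tau)(k''b+k')=c\,\sigma(k')+\tau(k'')$ for $0\le k'<b$, $0\le k''<c$. Faure's permutations $\omega_b$ of $\{0,\dots,b-1\}$, $b\ge 2$, are defined recursively as follows: $\omega_2=\mathrm{id}_2$ is the identity of $\{0,1\}$; $\omega_{2b}=\mathrm{id}_2\cdot\omega_b$ for $b\ge 2$; and, for $b\ge 1$, $\omega_{2b+1}(b)=b$, $\omega_{2b+1}(k)=g(\omega_{2b}(k))$ for $0\le k<b$ and $\omega_{2b+1}(k)=g(\omega_{2b}(k-1))$ for $b<k\le 2b$, where $g(v)=v$ if $v<b$ and $g(v)=v+1$ if $v\ge b$. For a permutation $\sigma$ of $\{0,\dots,b-1\}$, $b\ge2$, let $\mathcal S_b^\sigma=(S_b^\sigma(n))_{n\ge 0}$ be the generalised van der Corput sequence $S_b^{\sigma}(n)=\sum_{j\ge 0}\sigma(a_j(n))\,b^{-j-1}$, where $n=\sum_{j\ge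 0}a_j(n)b^j$ is the $b$-adic expansion of $n$. For a sequence $X$ of real numbers let $D_N(X)=\sup_{0\le\alpha<\beta\le 1}\bigl|A([\alpha,\beta),N,X)-(\beta-\alpha)N\bigr|$, where $A([\alpha,\beta),N,X)$ is the number of the first $N$ terms of $X$ whose fractional part lies in $[\alpha,\beta)$, and let $s(X)=\limsup_{N\to\infty}D_N(X)/\log N$. **Theorem.** For every $m\ge 0$, with $b_m=9\cdot 2^m$ and $\omega=\omega_{b_m}$, $$ s\bigl(\mathcal S_{b_m}^{\omega}\bigr)\;\le\;\frac{1}{3\log 2}\;=\;s\bigl(\mathcal S_2^{\mathrm{id}_2}\bigr). $$ In particular, for every $m\ge0$ there is a permutation $\sigma$ of $\{0,\dots,b_m-1\}$ with $s(\mathcal S_{b_m}^\sigma)\le 1/(3\log 2)=s(\mathcal S_2^{\mathrm{id}_2})$. -/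

import Mathlib

open Filter

noncomputable section

namespace VanDerCorput

/-! ### Discrepancy of a sequence of real numbers -/

/-- `A([α, β), N, X)`: the number of the first `N` points `X 0, …, X (N - 1)` whose fractional part
lies in `[α, β)`. -/
def countIn (α β : ℝ) (N : ℕ) (X : ℕ → ℝ) : ℕ :=
  Set.ncard {i : ℕ | i < N ∧ Int.fract (X i) ∈ Set.Ico α β}

/-- `E([α, β), N, X) = A([α, β), N, X) - (β - α) N`. -/
def localDiscrepancy (α β : ℝ) (N : ℕ) (X : ℕ → ℝ) : ℝ :=
  (countIn α β N X : ℝ) - (β - α) * N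

/-- The (unnormalised) extreme discrepancy `D_N(X)`: the supremum of `|E([α, β), N, X)|` over all
intervals `[α, β) ⊆ [0, 1)`. -/
def extremeDiscrepancy (N : ℕ) (X : ℕ → ℝ) : ℝ :=
  sSup {d : ℝ | ∃ α β : ℝ, 0 ≤ α ∧ α < β ∧ β ≤ 1 ∧ d = |localDiscrepancy α β N X|}

/-- The supremum in the definition of `D_N(X)` is over a bounded set. -/
theorem bddAbove_discrepancy (N : ℕ) (X : ℕ → ℝ) :
    BddAbove {d : ℝ | ∃ α β : ℝ, 0 ≤ α ∧ α < β ∧ β ≤ 1 ∧ d = |localDiscrepancy α β N X|} := by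
  refine ⟨N, ?_⟩
  rintro d ⟨α, β, h0, h1, h2, rfl⟩
  have hc : countIn α β N X ≤ N := by
    have h : {i : ℕ | i < N ∧ Int.fract (X i) ∈ Set.Ico α β} ⊆ (Finset.range N : Set ℕ) := by
      intro i hi
      simpa using hi.1
    have := Set.ncard_le_ncard h (Finset.finite_toSet _)
    simpa [countIn, Set.ncard_coe_finset] using this
  have hc' : (countIn α β N X : ℝ) ≤ N := by exact_mod_cast hc
  have hp : (0 : ℝ) ≤ countIn α β N X := by positivity
  have hN : (0 : ℝ) ≤ N := by positivity
  unfold localDiscrepancy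
  rw [abs_le]
  constructor <;> nlinarith

/-- The asymptotic constant `s(X) = limsup_{N → ∞} D_N(X) / log N`, as an extended real number. -/
def asymptoticConstant (X : ℕ → ℝ) : EReal :=
  limsup (fun N : ℕ => ((extremeDiscrepancy N X / Real.log N : ℝ) : EReal)) atTop

/-! ### Generalised van der Corput sequences -/

/-- The digit `a_j(n)` of `n` in base `b`. -/
def digit (b : ℕ) [NeZero b] (j n : ℕ) : Fin b :=
  ⟨n / b ^ j % b, Nat.mod_lt _ (Nat.pos_of_ne_zero (NeZero.ne b))⟩

/-- The generalised van der Corput sequence in base `b` for a sequence `σ` of permutations of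
`{0, …, b - 1}`: its `n`-th term is `∑_{j ≥ 0} σ_j(a_j(n)) / b ^ (j + 1)`. -/
def genVdC (b : ℕ) [NeZero b] (σ : ℕ → Equiv.Perm (Fin b)) (n : ℕ) : ℝ :=
  ∑' j : ℕ, ((σ j (digit b j n) : ℕ) : ℝ) / (b : ℝ) ^ (j + 1)

/-- The generalised van der Corput sequence generated by a single permutation. -/
def vdC (b : ℕ) [NeZero b] (σ : Equiv.Perm (Fin b)) : ℕ → ℝ :=
  genVdC b fun _ => σ

/-- In every base `b ≥ 2` the defining series converges. -/
theorem summable_genVdC {b : ℕ} [NeZero b] (hb : 2 ≤ b) (σ : ℕ → Equiv.Perm (Fin b)) (n : ℕ) :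
    Summable fun j : ℕ => ((σ j (digit b j n) : ℕ) : ℝ) / (b : ℝ) ^ (j + 1) := by
  have hb' : (1 : ℝ) < b := by exact_mod_cast hb
  have hb0 : (0 : ℝ) < b := by linarith
  refine Summable.of_nonneg_of_le (f := fun j : ℕ => ((b : ℝ)⁻¹) ^ j)
    (fun j => by positivity) (fun j => ?_)
    (summable_geometric_of_lt_one (by positivity) (inv_lt_one_of_one_lt₀ hb'))
  have h1 : ((σ j (digit b j n) : ℕ) : ℝ) ≤ b := by
    exact_mod_cast (σ j (digit b j n)).isLt.le
  rw [div_le_iff₀ (by positivity), pow_succ, ← mul_assoc, ← mul_pow, inv_mul_cancel₀ hb0.ne',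
    one_pow, one_mul]
  exact h1

/-! ### Faure's recursive algorithm -/

/-- The intrication `σ · τ` of a permutation `σ` of `{0, …, b - 1}` and a permutation `τ` of
`{0, …, c - 1}`: it sends `k'' b + k'` to `c σ(k') + τ(k'')`. -/
def intrication {b c : ℕ} (σ : Equiv.Perm (Fin b)) (τ : Equiv.Perm (Fin c)) :
    Equiv.Perm (Fin (b * c)) :=
  (finCongr (Nat.mul_comm b c)).trans <| finProdFinEquiv.symm.trans <|
    (Equiv.prodComm (Fin c) (Fin b)).trans <| (Equiv.prodCongr σ τ).trans finProdFinEquiv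

theorem intrication_apply {b c : ℕ} (σ : Equiv.Perm (Fin b)) (τ : Equiv.Perm (Fin c))
    (k' : Fin b) (k'' : Fin c) (h : (k'' : ℕ) * b + k' < b * c) :
    (intrication σ τ ⟨k'' * b + k', h⟩ : ℕ) = c * σ k' + τ k'' := by
  have : finCongr (Nat.mul_comm b c) ⟨k'' * b + k', h⟩ = finProdFinEquiv (k'', k') := by
    ext
    simp [finProdFinEquiv]
    ring
  simp only [intrication, Equiv.trans_apply]
  rw [this, Equiv.symm_apply_apply]
  simp [finProdFinEquiv]
  ring

/-- From a permutation `π` of `{0, …, 2 b - 1}`, the permutation of `{0, …, 2 b}` that fixes `b` and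
is `π` on the other numbers, once these are renumbered `0, …, 2 b - 1` in increasing order. -/
def insertMiddle {b : ℕ} (π : Equiv.Perm (Fin (2 * b))) : Equiv.Perm (Fin (2 * b + 1)) :=
  (finSuccEquiv' ⟨b, by omega⟩).trans <| (Equiv.optionCongr π).trans
    (finSuccEquiv' ⟨b, by omega⟩).symm

theorem insertMiddle_middle {b : ℕ} (π : Equiv.Perm (Fin (2 * b))) :
    (insertMiddle π ⟨b, by omega⟩ : ℕ) = b := by
  simp [insertMiddle]

theorem insertMiddle_of_lt {b : ℕ} (π : Equiv.Perm (Fin (2 * b))) (k : ℕ) (hk : k < b) :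
    (insertMiddle π ⟨k, by omega⟩ : ℕ) =
      if (π ⟨k, by omega⟩ : ℕ) < b then (π ⟨k, by omega⟩ : ℕ) else π ⟨k, by omega⟩ + 1 := by
  have : (⟨k, by omega⟩ : Fin (2 * b + 1)) =
      (⟨b, by omega⟩ : Fin (2 * b + 1)).succAbove ⟨k, by omega⟩ := by
    ext
    simp [Fin.succAbove, Fin.lt_def, hk]
  simp only [insertMiddle, Equiv.trans_apply]
  rw [this, finSuccEquiv'_succAbove]
  simp only [Equiv.optionCongr_apply, Option.map_some, finSuccEquiv'_symm_some, Fin.succAbove,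
    Fin.lt_def, Fin.val_castSucc]
  split_ifs <;> simp

theorem insertMiddle_of_gt {b : ℕ} (π : Equiv.Perm (Fin (2 * b))) (k : ℕ) (hk : b < k)
    (hk' : k ≤ 2 * b) :
    (insertMiddle π ⟨k, by omega⟩ : ℕ) =
      if (π ⟨k - 1, by omega⟩ : ℕ) < b then (π ⟨k - 1, by omega⟩ : ℕ)
      else π ⟨k - 1, by omega⟩ + 1 := by
  have : (⟨k, by omega⟩ : Fin (2 * b + 1)) =
      (⟨b, by omega⟩ : Fin (2 * b + 1)).succAbove ⟨k - 1, by omega⟩ := by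
    have h : ¬ (k - 1 < b) := by omega
    ext
    simp [Fin.succAbove, Fin.lt_def, h]
    omega
  simp only [insertMiddle, Equiv.trans_apply]
  rw [this, finSuccEquiv'_succAbove]
  simp only [Equiv.optionCongr_apply, Option.map_some, finSuccEquiv'_symm_some, Fin.succAbove,
    Fin.lt_def, Fin.val_castSucc]
  split_ifs <;> simp

/-- Faure's permutation `ω_b`, by recursion on the binary expansion of `b`: `ω_{2b} = id_2 · ω_b`, and
`ω_{2b+1}` arises from `id_2 · ω_b` by inserting the fixed point `b` in the middle. The recursion is
started at the empty permutation; this gives `ω_2 = id_2`. -/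
def faurePerm (b : ℕ) : Equiv.Perm (Fin b) :=
  Nat.binaryRec (motive := fun b => Equiv.Perm (Fin b)) (Equiv.refl (Fin 0))
    (fun bit b π => match bit with
      | false => (intrication (Equiv.refl (Fin 2)) π : Equiv.Perm (Fin (2 * b)))
      | true => (insertMiddle (intrication (Equiv.refl (Fin 2)) π) :
          Equiv.Perm (Fin (2 * b + 1)))) b

theorem faurePerm_two_mul (b : ℕ) :
    faurePerm (2 * b) = intrication (Equiv.refl (Fin 2)) (faurePerm b) := by
  exact Nat.binaryRec_eq (motive := fun b => Equiv.Perm (Fin b)) false b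
    (Or.inl (Subsingleton.elim (α := Equiv.Perm (Fin 0)) _ _))

theorem faurePerm_two_mul_add_one (b : ℕ) :
    faurePerm (2 * b + 1) = insertMiddle (faurePerm (2 * b)) := by
  rw [faurePerm_two_mul]
  exact Nat.binaryRec_eq (motive := fun b => Equiv.Perm (Fin b)) true b
    (Or.inl (Subsingleton.elim (α := Equiv.Perm (Fin 0)) _ _))

theorem faurePerm_two : faurePerm 2 = Equiv.refl (Fin 2) := by
  have h1 : ∀ x y : Fin 1, x = y := fun x y => Subsingleton.elim x y
  have h := faurePerm_two_mul 1
  ext k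
  have hk := intrication_apply (Equiv.refl (Fin 2)) (faurePerm 1) k 0 (by simp; omega)
  have h0 : ((faurePerm 1 0 : Fin 1) : ℕ) = 0 := by omega
  simp only [Fin.val_zero, zero_mul, zero_add, one_mul, Equiv.refl_apply, h0, add_zero] at hk
  change ((faurePerm (2 * 1)) k : ℕ) = _
  rw [h]
  exact hk

end VanDerCorput

end

namespace VanDerCorput

/-! ### Radical inverse maps and their discrepancy -/

/-! The first `n` digits of the index give a `B`-periodic radical inverse `T`, with `B = b ^ n`.
Processing a further digit adds to the discrepancy of an initial interval a term depending only on
that digit and on the fractional part of `N / B` (`initialDisc_addDigit`). For differences of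
initial discrepancies, the estimate carried through the digits is `log₂ B / 3 + ‖N / B‖ / 3`, where
`‖·‖` is the distance to the nearest integer. The correction is essential: a single digit may
contribute more than its share `log₂ b / 3`, but never in a way that the correction does not absorb.

In base `2` this amounts to `2‖x‖ + ‖2x‖ ≤ 1`; in base `9` it is a finite check together with `2 ^
19 ≤ 9 ^ 6`. Since `ω_{2b} = id_2 · ω_b`, a digit in base `2b` acts as a digit in base `2` followed
by one in base `b`. The bound thus passes from `9` to all `9 * 2 ^ m`, and rounding end points costs
only `O(1)`.

In base `2` a suitable end point attains `∑ ‖N / 2 ^ j‖` exactly. For `N = (2 ^ (n + 1) - 1) / 3`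
every summand is nearly `1 / 3`, so the constant `1 / (3 log 2)` is reached. -/

/-- `T` maps `ℕ` to `{0, …, B - 1}`, is `B`-periodic, and is bijective on each period. -/
structure IsRadicalInverse (B : ℕ) (T : ℕ → ℕ) : Prop where
  pos : 0 < B
  lt : ∀ i, T i < B
  fiber : ∀ u < B, ∃ m < B, ∀ i, T i = u ↔ i % B = m

/-- The radical inverse map obtained from `T` by processing one more digit in base `b`, permuted by
`s`. -/
def addDigit (b : ℕ) (s : ℕ → ℕ) (B : ℕ) (T : ℕ → ℕ) (i : ℕ) : ℕ :=
  b * T i + s (i / B % b)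

/-- The discrepancy of the first `N` values of `T` with respect to `{0, …, l - 1}`. -/
noncomputable def initialDisc (B : ℕ) (T : ℕ → ℕ) (l N : ℕ) : ℝ :=
  (Nat.count (fun i => T i < l) N : ℝ) - l * N / B

/-- The contribution of a single digit to the discrepancy: the affine interpolation in `t ∈ [0, 1]`
between the discrepancies of the first `q` and of the first `q + 1` values of the periodic
extension of `s`, with respect to `{0, …, h - 1}`. -/
noncomputable def digitDisc (b : ℕ) (s : ℕ → ℕ) (h q : ℕ) (t : ℝ) : ℝ :=
  (Nat.count (fun a => s (a % b) < h) q : ℝ) - h * (q + t) / b + if s (q % b) < h then t else 0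

theorem isRadicalInverse_one : IsRadicalInverse 1 fun _ => 0 :=
  ⟨one_pos, fun _ => one_pos, fun u hu => ⟨0, one_pos, fun i => by omega⟩⟩

theorem IsRadicalInverse.addDigit {b B : ℕ} {s T : ℕ → ℕ} (hT : IsRadicalInverse B T)
    (hb : 0 < b) (hs : Set.BijOn s (Set.Iio b) (Set.Iio b)) :
    IsRadicalInverse (B * b) (addDigit b s B T) where
  pos := Nat.mul_pos hT.pos hb
  lt i := by
    have h1 := hT.lt i
    have h2 : s (i / B % b) < b := hs.mapsTo (Nat.mod_lt _ hb)
    unfold VanDerCorput.addDigit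
    nlinarith
  fiber u hu := by
    have hub : u / b < B := Nat.div_lt_of_lt_mul (by rwa [mul_comm])
    obtain ⟨m, hm, hmT⟩ := hT.fiber (u / b) hub
    obtain ⟨a, ha, hau⟩ := hs.surjOn (show u % b ∈ Set.Iio b from Nat.mod_lt _ hb)
    have ha' : a < b := ha
    refine ⟨m + B * a, by nlinarith, fun i => ?_⟩
    have hlt : s (i / B % b) < b := hs.mapsTo (Nat.mod_lt _ hb)
    have h1 : VanDerCorput.addDigit b s B T i = u ↔ T i = u / b ∧ s (i / B % b) = u % b := by
      unfold VanDerCorput.addDigit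
      constructor
      · rintro rfl
        rw [Nat.mul_add_div hb, Nat.div_eq_of_lt hlt, Nat.mul_add_mod, Nat.mod_eq_of_lt hlt]
        simp
      · rintro ⟨h, h'⟩
        rw [h, h', Nat.div_add_mod]
    have h2 : s (i / B % b) = u % b ↔ i / B % b = a := by
      rw [← hau]
      exact hs.injOn.eq_iff (Nat.mod_lt _ hb) ha
    rw [h1, hmT, h2, Nat.mod_mul]
    constructor
    · rintro ⟨rfl, rfl⟩
      rfl
    · intro h
      have hi := Nat.mod_lt i hT.pos
      have e1 := congrArg (· % B) h
      have e2 := congrArg (· / B) h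
      simp only [Nat.add_mul_mod_self_left, Nat.mod_mod, Nat.mod_eq_of_lt hm] at e1
      simp only [Nat.add_mul_div_left _ _ hT.pos, Nat.div_eq_of_lt hi, Nat.div_eq_of_lt hm,
        zero_add] at e2
      exact ⟨e1, e2⟩

/-- Each block of `B` consecutive indices meets the residue class of `m` once. Allowing `r = B` lets
the induction on `q` close a full block. -/
theorem count_mod_eq_and {B m : ℕ} (hm : m < B) (p : ℕ → Prop) [DecidablePred p] (q r : ℕ)
    (hr : r ≤ B) :
    Nat.count (fun i => i % B = m ∧ p (i / B)) (B * q + r) =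
      Nat.count p q + if m < r ∧ p q then 1 else 0 := by
  have hB : 0 < B := by omega
  have key : ∀ q, Nat.count (fun i => i % B = m ∧ p (i / B)) (B * q) = Nat.count p q →
      ∀ r ≤ B, Nat.count (fun i => i % B = m ∧ p (i / B)) (B * q + r) =
        Nat.count p q + if m < r ∧ p q then 1 else 0 := by
    intro q hq r
    induction r with
    | zero => intro _; simpa using hq
    | succ r ih =>
      intro hr
      have hrB : r < B := hr
      rw [← add_assoc, Nat.count_succ, ih hrB.le, Nat.mul_add_mod, Nat.mod_eq_of_lt hrB,
        Nat.mul_add_div hB, Nat.div_eq_of_lt hrB, add_zero, add_assoc]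
      congr 1
      by_cases hp : p q
      · simp only [hp, and_true]
        split_ifs <;> omega
      · simp [hp]
  refine key q ?_ r hr
  clear r hr
  induction q with
  | zero => simp
  | succ q ih =>
    rw [mul_add, mul_one, key q ih B le_rfl, Nat.count_succ]
    simp [hm]

theorem count_or_of_disjoint {p q : ℕ → Prop} [DecidablePred p] [DecidablePred q]
    (h : ∀ i, p i → ¬ q i) (N : ℕ) :
    Nat.count (fun i => p i ∨ q i) N = Nat.count p N + Nat.count q N := by
  induction N with
  | zero => simp
  | succ N ih =>
    simp only [Nat.count_succ, ih]
    have := h N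
    split_ifs <;> simp_all <;> omega

/-- Processing one more digit changes the discrepancy by the contribution of that digit. -/
theorem initialDisc_addDigit {b B : ℕ} {s T : ℕ → ℕ} (hT : IsRadicalInverse B T) (hb : 0 < b)
    (hs : Set.BijOn s (Set.Iio b) (Set.Iio b)) {u h : ℕ} (hu : u < B) (hh : h ≤ b) (N : ℕ) :
    initialDisc (B * b) (addDigit b s B T) (b * u + h) N =
      initialDisc B T (if s (N / B % b) < h then u + 1 else u) N +
        digitDisc b s h (N / B) ((N % B : ℕ) / B) := by
  obtain ⟨m, hm, hmT⟩ := hT.fiber u hu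
  have hBpos : (0 : ℝ) < B := by exact_mod_cast hT.pos
  have hbpos : (0 : ℝ) < b := by exact_mod_cast hb
  have hr : N % B ≤ B := (Nat.mod_lt N hT.pos).le
  have c1 : Nat.count (fun i => addDigit b s B T i < b * u + h) N =
      Nat.count (fun i => T i < u) N + (Nat.count (fun a => s (a % b) < h) (N / B) +
        if m < N % B ∧ s (N / B % b) < h then 1 else 0) := by
    have e : (fun i => addDigit b s B T i < b * u + h) =
        fun i => T i < u ∨ (i % B = m ∧ s (i / B % b) < h) := by
      funext i
      have hlt : s (i / B % b) < b := hs.mapsTo (Nat.mod_lt _ hb)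
      rw [← hmT, eq_iff_iff]
      unfold addDigit
      rcases lt_trichotomy (T i) u with h1 | h1 | h1
      · simp only [h1, true_or, iff_true]
        nlinarith
      · simp [h1]
      · have : ¬ (b * T i + s (i / B % b) < b * u + h) := by nlinarith
        simp [this, h1.not_gt, h1.ne']
    have key := count_mod_eq_and hm (fun a => s (a % b) < h) (N / B) (N % B) hr
    rw [Nat.div_add_mod] at key
    simp only [e]
    rw [count_or_of_disjoint, key]
    intro i hi hi'
    exact hi.ne ((hmT i).2 hi'.1)
  have c2 : Nat.count (fun i => T i < u + 1) N =
      Nat.count (fun i => T i < u) N + (N / B + if m < N % B then 1 else 0) := by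
    have e : (fun i => T i < u + 1) = fun i => T i < u ∨ (i % B = m ∧ True) := by
      funext i
      rw [and_true, ← hmT, eq_iff_iff]
      omega
    have key := count_mod_eq_and hm (fun _ => True) (N / B) (N % B) hr
    rw [Nat.div_add_mod] at key
    simp only [e]
    rw [count_or_of_disjoint, key]
    · simp
    · intro i hi hi'
      exact hi.ne ((hmT i).2 hi'.1)
  have hN : (N : ℝ) = B * (N / B : ℕ) + (N % B : ℕ) := by exact_mod_cast (Nat.div_add_mod N B).symm
  unfold initialDisc digitDisc
  rw [c1]
  set q := N / B
  set r := N % B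
  set c := Nat.count (fun i => T i < u) N
  set C := Nat.count (fun a => s (a % b) < h) q
  -- If the current digit is counted, the end point `u + 1` absorbs the indicator of `m < r`;
  -- otherwise that indicator is absent. Either way the remainder no longer depends on `m`.
  by_cases hp : s (q % b) < h
  · simp only [hp, if_true, and_true]
    rw [c2, hN]
    push_cast
    field_simp
    ring
  · simp only [hp, if_false, and_false]
    rw [hN]
    push_cast
    field_simp
    ring

/-- The distance from `N / B` to the nearest integer. -/
noncomputable def nearestDist (B N : ℕ) : ℝ :=
  min ((N % B : ℕ) / B) (1 - (N % B : ℕ) / B)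

theorem nearestDist_nonneg {B : ℕ} (hB : 0 < B) (N : ℕ) : 0 ≤ nearestDist B N := by
  have hBpos : (0 : ℝ) < B := by exact_mod_cast hB
  have h : ((N % B : ℕ) : ℝ) / B ≤ 1 :=
    div_le_one_of_le₀ (by exact_mod_cast (Nat.mod_lt N hB).le) hBpos.le
  exact le_min (by positivity) (by linarith)

theorem nearestDist_le_half (B N : ℕ) : nearestDist B N ≤ 1 / 2 := by
  unfold nearestDist
  rcases le_total (((N % B : ℕ) : ℝ) / B) (1 / 2) with h | h
  · exact (min_le_left _ _).trans h
  · exact (min_le_right _ _).trans (by linarith)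

theorem nearestDist_mul {b B : ℕ} (hb : 0 < b) (hB : 0 < B) (N : ℕ) :
    nearestDist (B * b) N =
      min (((N / B % b : ℕ) + (N % B : ℕ) / (B : ℝ)) / b)
        (1 - ((N / B % b : ℕ) + (N % B : ℕ) / (B : ℝ)) / b) := by
  have hBpos : (0 : ℝ) < B := by exact_mod_cast hB
  have hbpos : (0 : ℝ) < b := by exact_mod_cast hb
  have h : ((N % (B * b) : ℕ) : ℝ) / (B * b : ℕ) =
      ((N / B % b : ℕ) + (N % B : ℕ) / (B : ℝ)) / b := by
    rw [Nat.mod_mul]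
    push_cast
    field_simp
    ring
  unfold nearestDist
  rw [h]

/-- `T` is a radical inverse map whose discrepancy is at most `log₂ B / 3`, up to a correction term
that makes the estimate stable under processing further digits. -/
structure HasBinaryBound (B : ℕ) (T : ℕ → ℕ) : Prop extends IsRadicalInverse B T where
  bound : ∀ l ≤ B, ∀ l' ≤ B, ∀ N,
    initialDisc B T l N - initialDisc B T l' N ≤ Real.logb 2 B / 3 + nearestDist B N / 3

/-- Processing a digit in base `b` with `s` preserves `HasBinaryBound`. -/
def PreservesBinaryBound (b : ℕ) (s : ℕ → ℕ) : Prop :=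
  ∀ B T, HasBinaryBound B T → HasBinaryBound (B * b) (addDigit b s B T)

theorem hasBinaryBound_one : HasBinaryBound 1 fun _ => 0 where
  toIsRadicalInverse := isRadicalInverse_one
  bound := by
    have h : ∀ l ≤ 1, ∀ N, initialDisc 1 (fun _ => 0) l N = 0 := by
      intro l hl N
      interval_cases l <;> simp [initialDisc]
    intro l hl l' hl' N
    rw [h l hl, h l' hl']
    simpa using div_nonneg (nearestDist_nonneg one_pos N) zero_le_three

/-- Division by `b` splits every end point except the full one, `B * b`. There all terms vanish, so
`h = 0` serves and `h < b` can always be kept. -/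
theorem exists_initialDisc_addDigit {b B : ℕ} {s T : ℕ → ℕ} (hT : IsRadicalInverse B T)
    (hb : 0 < b) (hs : Set.BijOn s (Set.Iio b) (Set.Iio b)) {l : ℕ} (hl : l ≤ B * b) (N : ℕ) :
    ∃ l' ≤ B, ∃ h < b, initialDisc (B * b) (addDigit b s B T) l N =
      initialDisc B T l' N + digitDisc b s h (N / B) ((N % B : ℕ) / B) := by
  rcases hl.eq_or_lt with rfl | hl
  · refine ⟨B, le_rfl, 0, hb, ?_⟩
    have hBpos : (B : ℝ) ≠ 0 := by exact_mod_cast hT.pos.ne'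
    have hbpos : (b : ℝ) ≠ 0 := by exact_mod_cast hb.ne'
    have hT' := hT.addDigit hb hs
    simp only [initialDisc, digitDisc, hT.lt, hT'.lt]
    simp
    field_simp
  · have hu : l / b < B := Nat.div_lt_of_lt_mul (by rwa [mul_comm])
    have := initialDisc_addDigit hT hb hs hu (Nat.mod_lt l hb).le N
    rw [Nat.div_add_mod] at this
    refine ⟨_, ?_, _, Nat.mod_lt l hb, this⟩
    split_ifs <;> omega

theorem count_lt_of_bijOn {b : ℕ} {s : ℕ → ℕ} (hs : Set.BijOn s (Set.Iio b) (Set.Iio b)) {h : ℕ}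
    (hh : h ≤ b) : Nat.count (fun a => s (a % b) < h) b = h := by
  rw [Nat.count_eq_card_filter_range]
  conv_rhs => rw [← Finset.card_range h]
  refine Finset.card_nbij s ?_ ?_ ?_
  · intro a ha
    simp only [Finset.coe_filter, Finset.mem_range, Set.mem_ofPred_eq] at ha
    rw [Nat.mod_eq_of_lt ha.1] at ha
    simpa using ha.2
  · intro a ha a' ha' hEq
    simp only [Finset.coe_filter, Finset.mem_range, Set.mem_ofPred_eq] at ha ha'
    exact hs.injOn ha.1 ha'.1 hEq
  · intro v hv
    have hv' : v < h := by simpa using hv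
    obtain ⟨a, ha, rfl⟩ := hs.surjOn (show v ∈ Set.Iio b from hv'.trans_le hh)
    have ha' : a < b := ha
    refine ⟨a, ?_, rfl⟩
    simp [Nat.mod_eq_of_lt ha', ha', hv']

/-- A full period of digits has discrepancy zero. -/
theorem digitDisc_mod {b : ℕ} {s : ℕ → ℕ} (hb : 0 < b) (hs : Set.BijOn s (Set.Iio b) (Set.Iio b))
    {h : ℕ} (hh : h ≤ b) (q : ℕ) (t : ℝ) : digitDisc b s h (q % b) t = digitDisc b s h q t := by
  have hbpos : (b : ℝ) ≠ 0 := by exact_mod_cast hb.ne'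
  have hc : ∀ k d, Nat.count (fun a => s (a % b) < h) (b * k + d) =
      h * k + Nat.count (fun a => s (a % b) < h) d := by
    intro k d
    induction k with
    | zero => simp
    | succ k ih =>
      rw [show b * (k + 1) + d = b + (b * k + d) by ring, Nat.count_add]
      simp only [Nat.add_mod_left]
      rw [ih, count_lt_of_bijOn hs hh]
      ring
  have hq := Nat.div_add_mod q b
  have hc' := hc (q / b) (q % b)
  rw [hq] at hc'
  have hqR : (q : ℝ) = b * (q / b : ℕ) + (q % b : ℕ) := by exact_mod_cast hq.symm
  unfold digitDisc
  rw [hc', Nat.mod_mod, hqR]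
  push_cast
  field_simp
  ring

/-- A criterion for `PreservesBinaryBound`, in terms of the digit `d` and the fractional part `t`
of `N / B`. -/
theorem preservesBinaryBound_of_digitDisc {b : ℕ} {s : ℕ → ℕ} (hb : 0 < b)
    (hs : Set.BijOn s (Set.Iio b) (Set.Iio b))
    (hd : ∀ h < b, ∀ h' < b, ∀ d < b, ∀ t : ℝ, 0 ≤ t → t ≤ 1 →
      digitDisc b s h d t - digitDisc b s h' d t + min t (1 - t) / 3 ≤
        Real.logb 2 b / 3 + min ((d + t) / b) (1 - (d + t) / b) / 3) :
    PreservesBinaryBound b s := by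
  intro B T hT
  refine ⟨hT.addDigit hb hs, fun l hl l' hl' N => ?_⟩
  obtain ⟨u, hu, h, hh, e⟩ := exists_initialDisc_addDigit hT.toIsRadicalInverse hb hs hl N
  obtain ⟨u', hu', h', hh', e'⟩ := exists_initialDisc_addDigit hT.toIsRadicalInverse hb hs hl' N
  have hBpos : (0 : ℝ) < B := by exact_mod_cast hT.pos
  have hbpos : (0 : ℝ) < b := by exact_mod_cast hb
  have h1 := hT.bound u hu u' hu' N
  have h2 := hd h hh h' hh' (N / B % b) (Nat.mod_lt _ hb) ((N % B : ℕ) / B) (by positivity)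
    (div_le_one_of_le₀ (by exact_mod_cast (Nat.mod_lt N hT.pos).le) hBpos.le)
  rw [digitDisc_mod hb hs hh.le, digitDisc_mod hb hs hh'.le] at h2
  -- The logarithmic terms add, and the old correction `min t (1 - t) / 3` cancels between `h1` and
  -- `h2`.
  rw [e, e', nearestDist_mul hb hT.pos, Nat.cast_mul, Real.logb_mul hBpos.ne' hbpos.ne']
  unfold nearestDist at h1
  linarith

/-! ### Digits in base `2` -/

theorem bijOn_id_two : Set.BijOn (id : ℕ → ℕ) (Set.Iio 2) (Set.Iio 2) := Set.bijOn_id _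

theorem digitDisc_two_zero (q : ℕ) (t : ℝ) : digitDisc 2 id 0 q t = 0 := by
  simp [digitDisc]

theorem digitDisc_two_one {d : ℕ} (hd : d < 2) {t : ℝ} (h0 : 0 ≤ t) (h1 : t ≤ 1) :
    digitDisc 2 id 1 d t = min ((d + t) / 2) (1 - (d + t) / 2) := by
  interval_cases d
  · rw [min_eq_left (by push_cast; linarith)]
    simp [digitDisc]
    linarith
  · rw [min_eq_right (by push_cast; linarith)]
    simp [digitDisc, Nat.count_succ]

/-- With `x = (d + t) / 2` the digit contributes at most `‖x‖`, so `2‖x‖ + ‖2x‖ ≤ 1` suffices. The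
cases `‖x‖ = 1 / 4` and `‖x‖ = 1 / 2` force the weight `1 / 3` of the correction. -/
theorem preservesBinaryBound_two : PreservesBinaryBound 2 id := by
  refine preservesBinaryBound_of_digitDisc two_pos bijOn_id_two ?_
  intro h hh h' hh' d hd t h0 h1
  have key : digitDisc 2 id h d t - digitDisc 2 id h' d t ≤
      min ((d + t) / 2) (1 - (d + t) / 2) ∧ 0 ≤ min (((d : ℝ) + t) / 2) (1 - (d + t) / 2) := by
    have hdR : (d : ℝ) ≤ 1 := by exact_mod_cast Nat.lt_succ_iff.1 hd
    have hnn : 0 ≤ min (((d : ℝ) + t) / 2) (1 - (d + t) / 2) :=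
      le_min (by positivity) (by linarith)
    refine ⟨?_, hnn⟩
    interval_cases h <;> interval_cases h' <;>
      simp only [digitDisc_two_zero, digitDisc_two_one hd h0 h1] <;> linarith
  push_cast
  rw [Real.logb_self_eq_one one_lt_two]
  have h2 : min (((d : ℝ) + t) / 2) (1 - (d + t) / 2) * 2 + min t (1 - t) ≤ 1 := by
    interval_cases d
    · have := min_le_left ((((0 : ℕ) : ℝ) + t) / 2) (1 - (((0 : ℕ) : ℝ) + t) / 2)
      have := min_le_right t (1 - t)
      push_cast at *
      linarith
    · have := min_le_right ((((1 : ℕ) : ℝ) + t) / 2) (1 - (((1 : ℕ) : ℝ) + t) / 2)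
      have := min_le_left t (1 - t)
      push_cast at *
      linarith
  linarith [key.1]

/-! ### Digits in base `9` -/

/-- Faure's permutation of `{0, …, 8}`. -/
def faureNine (k : ℕ) : ℕ := [0, 5, 2, 7, 4, 1, 6, 3, 8].getD k 0

theorem bijOn_faureNine : Set.BijOn faureNine (Set.Iio 9) (Set.Iio 9) := by
  refine ⟨?_, ?_, ?_⟩
  · have : ∀ k < 9, faureNine k < 9 := by decide
    exact this
  · have : ∀ k < 9, ∀ l < 9, faureNine k = faureNine l → k = l := by decide
    exact fun k hk l hl => this k hk l hl
  · have : ∀ v < 9, ∃ k < 9, faureNine k = v := by decide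
    exact this

/-- `9` times the discrepancy of `d` points, maximised over all intervals. -/
def faureNineBound (d : ℕ) : ℕ := [0, 8, 8, 9, 8, 8, 9, 8, 8, 0].getD d 0

/-- Denominators and subtractions are cleared to leave a finite check in `ℕ`. -/
theorem count_faureNine_sub_le : ∀ d ≤ 9, ∀ h < 9, ∀ h' < 9,
    9 * Nat.count (fun a => faureNine (a % 9) < h) d + h' * d ≤
      9 * Nat.count (fun a => faureNine (a % 9) < h') d + h * d + faureNineBound d := by
  decide

theorem digitDisc_eq_interpolation {b : ℕ} (hb : 0 < b) (s : ℕ → ℕ) (h q : ℕ) (t : ℝ) :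
    b * digitDisc b s h q t =
      (1 - t) * (b * Nat.count (fun a => s (a % b) < h) q - h * q) +
        t * (b * Nat.count (fun a => s (a % b) < h) (q + 1) - h * (q + 1)) := by
  have hbpos : (b : ℝ) ≠ 0 := by exact_mod_cast hb.ne'
  unfold digitDisc
  rw [Nat.count_succ]
  push_cast
  split_ifs <;> field_simp <;> ring

/-- Sixth powers: `2 ^ 19 = 524288 ≤ 531441 = 9 ^ 6`. -/
theorem nineteen_le_logb_nine : 19 / 6 ≤ Real.logb 2 9 := by
  rw [Real.le_logb_iff_rpow_le one_lt_two (by norm_num)]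
  have h : ((2 : ℝ) ^ (19 / 6 : ℝ)) ^ (6 : ℕ) ≤ 9 ^ 6 := by
    rw [← Real.rpow_natCast, ← Real.rpow_mul zero_le_two]
    norm_num
  exact le_of_pow_le_pow_left₀ (by norm_num) (by norm_num) h

theorem preservesBinaryBound_faureNine : PreservesBinaryBound 9 faureNine := by
  refine preservesBinaryBound_of_digitDisc (by norm_num) bijOn_faureNine ?_
  intro h hh h' hh' d hd t h0 h1
  have c1 : (9 * Nat.count (fun a => faureNine (a % 9) < h) d + h' * d : ℝ) ≤
      9 * Nat.count (fun a => faureNine (a % 9) < h') d + h * d + faureNineBound d := by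
    exact_mod_cast count_faureNine_sub_le d hd.le h hh h' hh'
  -- Here `d + 1` may be `9`, a full period; hence the last entry `0` of the table.
  have c2 : (9 * Nat.count (fun a => faureNine (a % 9) < h) (d + 1) + h' * (d + 1) : ℝ) ≤
      9 * Nat.count (fun a => faureNine (a % 9) < h') (d + 1) + h * (d + 1) +
        faureNineBound (d + 1) := by
    exact_mod_cast count_faureNine_sub_le (d + 1) hd h hh h' hh'
  have e1 := digitDisc_eq_interpolation (b := 9) (by norm_num) faureNine h d t
  have e2 := digitDisc_eq_interpolation (b := 9) (by norm_num) faureNine h' d t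
  have c3 := mul_le_mul_of_nonneg_left c1 (sub_nonneg.2 h1)
  have c4 := mul_le_mul_of_nonneg_left c2 h0
  have key : 9 * (digitDisc 9 faureNine h d t - digitDisc 9 faureNine h' d t) ≤
      (1 - t) * faureNineBound d + t * faureNineBound (d + 1) := by
    push_cast at e1 e2
    linarith
  have hm1 := min_le_left t (1 - t)
  have hm2 := min_le_right t (1 - t)
  -- Here `19 / 2 = 9 * (19 / 6) / 3`. For `d = 3`, `t = 1 / 2` the left side can be `10`, so the
  -- correction on the right is needed.
  have h3 : (1 - t) * faureNineBound d + t * faureNineBound (d + 1) + 3 * min t (1 - t) ≤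
      19 / 2 + 3 * min (((d : ℝ) + t) / 9) (1 - (d + t) / 9) := by
    rcases min_choice (((d : ℝ) + t) / 9) (1 - (d + t) / 9) with e | e <;> rw [e] <;>
      interval_cases d <;> norm_num [faureNineBound] <;> linarith
  have := nineteen_le_logb_nine
  push_cast
  linarith

/-! ### Permutations as functions on `ℕ` -/

/-- A permutation of `{0, …, b - 1}` as a function on `ℕ`. -/
def permFun {b : ℕ} (σ : Equiv.Perm (Fin b)) (a : ℕ) : ℕ :=
  if h : a < b then σ ⟨a, h⟩ else 0

theorem permFun_of_lt {b : ℕ} (σ : Equiv.Perm (Fin b)) {a : ℕ} (h : a < b) :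
    permFun σ a = σ ⟨a, h⟩ := by
  simp [permFun, h]

theorem addDigit_congr {b : ℕ} (hb : 0 < b) {s s' : ℕ → ℕ} (h : ∀ a < b, s a = s' a) (B : ℕ)
    (T : ℕ → ℕ) : addDigit b s B T = addDigit b s' B T := by
  funext i
  unfold addDigit
  rw [h _ (Nat.mod_lt _ hb)]

theorem PreservesBinaryBound.congr {b : ℕ} (hb : 0 < b) {s s' : ℕ → ℕ} (h : ∀ a < b, s a = s' a)
    (hs : PreservesBinaryBound b s) : PreservesBinaryBound b s' := by
  intro B T hT
  rw [← addDigit_congr hb h]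
  exact hs B T hT

/-- Intrication with the identity in base `2` amounts to processing two digits, in bases `2`
and `c`. -/
theorem addDigit_intrication {c : ℕ} (hc : 0 < c) (τ : Equiv.Perm (Fin c)) (B : ℕ) (T : ℕ → ℕ) :
    addDigit (2 * c) (permFun (intrication (Equiv.refl (Fin 2)) τ)) B T =
      addDigit c (permFun τ) (B * 2) (addDigit 2 id B T) := by
  funext i
  have hk : i / B % (2 * c) < 2 * c := Nat.mod_lt _ (by omega)
  have h1 : i / B % (2 * c) / 2 = i / (B * 2) % c := by
    rw [Nat.mod_mul_right_div_self, Nat.div_div_eq_div_mul]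
  have h2 : i / B % (2 * c) % 2 = i / B % 2 := by
    rw [Nat.mod_mul_right_mod]
  have hlt : i / (B * 2) % c < c := Nat.mod_lt _ hc
  have hlt2 : i / B % 2 < 2 := Nat.mod_lt _ two_pos
  have e : i / B % (2 * c) = i / (B * 2) % c * 2 + i / B % 2 := by
    rw [← h1, ← h2, Nat.div_add_mod']
  have hlt3 : i / (B * 2) % c * 2 + i / B % 2 < 2 * c := e ▸ hk
  have key := intrication_apply (Equiv.refl (Fin 2)) τ ⟨i / B % 2, hlt2⟩ ⟨i / (B * 2) % c, hlt⟩
    hlt3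
  simp only [addDigit]
  rw [e, permFun_of_lt _ hlt3, permFun_of_lt _ hlt, key]
  simp
  ring

theorem preservesBinaryBound_faurePerm_two_mul {b : ℕ} (hb : 0 < b)
    (h : PreservesBinaryBound b (permFun (faurePerm b))) :
    PreservesBinaryBound (2 * b) (permFun (faurePerm (2 * b))) := by
  intro B T hT
  rw [faurePerm_two_mul, addDigit_intrication hb, ← mul_assoc]
  exact h _ _ (preservesBinaryBound_two B T hT)

theorem permFun_faurePerm_two_mul_zero {b : ℕ} (hb : 0 < b)
    (h : permFun (faurePerm b) 0 = 0) : permFun (faurePerm (2 * b)) 0 = 0 := by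
  have key := intrication_apply (Equiv.refl (Fin 2)) (faurePerm b) 0 ⟨0, hb⟩ (by simp; omega)
  rw [permFun_of_lt _ hb] at h
  rw [faurePerm_two_mul, permFun_of_lt _ (by omega)]
  simpa [h] using key

theorem permFun_faurePerm_nine : ∀ a < 9, faureNine a = permFun (faurePerm 9) a := by
  have h1 : faurePerm 1 = Equiv.refl (Fin 1) := Subsingleton.elim (α := Equiv.Perm (Fin 1)) _ _
  -- The recursion is unrolled into explicit permutations that `decide` can evaluate.
  have h9 : faurePerm 9 = insertMiddle (b := 4) (intrication (b := 2) (c := 4) (Equiv.refl (Fin 2))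
      (intrication (b := 2) (c := 2) (Equiv.refl (Fin 2))
        (intrication (b := 2) (c := 1) (Equiv.refl (Fin 2)) (Equiv.refl (Fin 1))))) := by
    rw [← h1]
    erw [← faurePerm_two_mul 1, ← faurePerm_two_mul 2, ← faurePerm_two_mul 4]
    exact faurePerm_two_mul_add_one 4
  rw [h9]
  decide

theorem preservesBinaryBound_faurePerm (m : ℕ) :
    PreservesBinaryBound (9 * 2 ^ m) (permFun (faurePerm (9 * 2 ^ m))) ∧
      permFun (faurePerm (9 * 2 ^ m)) 0 = 0 := by
  induction m with
  | zero =>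
    exact ⟨preservesBinaryBound_faureNine.congr (by norm_num) permFun_faurePerm_nine,
      (permFun_faurePerm_nine 0 (by norm_num)).symm⟩
  | succ m ih =>
    have hb : 0 < 9 * 2 ^ m := by positivity
    rw [show 9 * 2 ^ (m + 1) = 2 * (9 * 2 ^ m) by ring]
    exact ⟨preservesBinaryBound_faurePerm_two_mul hb ih.1,
      permFun_faurePerm_two_mul_zero hb ih.2⟩

/-! ### Radical inverses and van der Corput sequences -/

/-- The radical inverse of the last `n` digits in base `b`, multiplied by `b ^ n`. -/
def radicalInverse (b : ℕ) (s : ℕ → ℕ) : ℕ → ℕ → ℕ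
  | 0 => fun _ => 0
  | n + 1 => addDigit b s (b ^ n) (radicalInverse b s n)

theorem hasBinaryBound_radicalInverse {b : ℕ} {s : ℕ → ℕ} (hs : PreservesBinaryBound b s) (n : ℕ) :
    HasBinaryBound (b ^ n) (radicalInverse b s n) := by
  induction n with
  | zero => exact hasBinaryBound_one
  | succ n ih => exact pow_succ b n ▸ hs _ _ ih

theorem sum_range_eq_radicalInverse {b : ℕ} [NeZero b] (σ : Equiv.Perm (Fin b)) (n i : ℕ) :
    ∑ j ∈ Finset.range n, ((σ (digit b j i) : ℕ) : ℝ) / (b : ℝ) ^ (j + 1) =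
      radicalInverse b (permFun σ) n i / (b : ℝ) ^ n := by
  have hb : (b : ℝ) ≠ 0 := by exact_mod_cast NeZero.ne b
  induction n with
  | zero => simp [radicalInverse]
  | succ n ih =>
    rw [Finset.sum_range_succ, ih]
    simp only [radicalInverse, addDigit]
    rw [permFun_of_lt _ (Nat.mod_lt _ (Nat.pos_of_ne_zero (NeZero.ne b)))]
    push_cast
    rw [pow_succ]
    field_simp
    rfl

/-- As `σ` fixes `0`, the zero digits from position `n` on contribute nothing and the series is a
finite sum. -/
theorem vdC_eq_radicalInverse {b : ℕ} [NeZero b] {σ : Equiv.Perm (Fin b)} (h0 : permFun σ 0 = 0)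
    {n i : ℕ} (hi : i < b ^ n) :
    vdC b σ i = radicalInverse b (permFun σ) n i / ((b ^ n : ℕ) : ℝ) := by
  have hb : 0 < b := Nat.pos_of_ne_zero (NeZero.ne b)
  rw [Nat.cast_pow, ← sum_range_eq_radicalInverse]
  refine tsum_eq_sum fun j hj => ?_
  have hj' : n ≤ j := by simpa using hj
  have hd : digit b j i = ⟨0, hb⟩ := by
    ext
    simp [digit, Nat.div_eq_of_lt (hi.trans_le (Nat.pow_le_pow_right hb hj'))]
  rw [permFun_of_lt _ hb] at h0
  rw [hd, h0]
  simp

/-- All points are multiples of `1 / B` in `[0, 1)`, so real end points may be rounded up without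
changing the count. -/
theorem countIn_eq_of_radicalInverse {B N : ℕ} {T : ℕ → ℕ} {X : ℕ → ℝ} (hT : IsRadicalInverse B T)
    (hX : ∀ i < N, X i = T i / (B : ℝ)) {α β : ℝ} (hαβ : α ≤ β) :
    (countIn α β N X : ℝ) = Nat.count (fun i => T i < ⌈β * B⌉₊) N -
      Nat.count (fun i => T i < ⌈α * B⌉₊) N := by
  have hB : (0 : ℝ) < B := by exact_mod_cast hT.pos
  have hset : {i : ℕ | i < N ∧ Int.fract (X i) ∈ Set.Ico α β} =
      ((Finset.range N).filter fun i => ⌈α * B⌉₊ ≤ T i ∧ T i < ⌈β * B⌉₊ : Finset ℕ) := by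
    ext i
    simp only [Finset.coe_filter, Finset.mem_range, Set.mem_ofPred_eq, Set.mem_Ico]
    refine and_congr_right fun hi => ?_
    have hlt : (T i : ℝ) < B := by exact_mod_cast hT.lt i
    rw [hX i hi, Int.fract_eq_self.2 ⟨by positivity, (div_lt_one hB).2 hlt⟩, le_div_iff₀ hB,
      div_lt_iff₀ hB, Nat.ceil_le, Nat.lt_ceil]
  have hle : ⌈α * B⌉₊ ≤ ⌈β * B⌉₊ := Nat.ceil_mono (by gcongr)
  have hcount : Nat.count (fun i => T i < ⌈β * B⌉₊) N = Nat.count (fun i => T i < ⌈α * B⌉₊) N +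
      Nat.count (fun i => ⌈α * B⌉₊ ≤ T i ∧ T i < ⌈β * B⌉₊) N := by
    rw [← count_or_of_disjoint (fun i h h' => h'.1.not_gt h)]
    congr 1
    funext i
    rw [eq_iff_iff]
    omega
  rw [countIn, hset, Set.ncard_coe_finset, ← Nat.count_eq_card_filter_range, hcount]
  push_cast
  ring

/-- Rounding the end points of an interval to multiples of `1 / B` changes the discrepancy of at
most `B` points by at most `1`. -/
theorem abs_localDiscrepancy_le {B N : ℕ} {T : ℕ → ℕ} {X : ℕ → ℝ} (hT : HasBinaryBound B T)
    (hX : ∀ i < N, X i = T i / (B : ℝ)) (hN : N ≤ B) {α β : ℝ} (h0 : 0 ≤ α) (hαβ : α ≤ β)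
    (h1 : β ≤ 1) : |localDiscrepancy α β N X| ≤ Real.logb 2 B / 3 + 7 / 6 := by
  have hB : (0 : ℝ) < B := by exact_mod_cast hT.pos
  have hNB : (N : ℝ) ≤ B := by exact_mod_cast hN
  have hαB := Nat.ceil_lt_add_one (show 0 ≤ α * B by positivity)
  have hβB := Nat.ceil_lt_add_one (show 0 ≤ β * B from mul_nonneg (h0.trans hαβ) hB.le)
  have hαB' := Nat.le_ceil (α * B)
  have hβB' := Nat.le_ceil (β * B)
  have hα1 : ⌈α * B⌉₊ ≤ B := Nat.ceil_le.2 (by nlinarith)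
  have hβ1 : ⌈β * B⌉₊ ≤ B := Nat.ceil_le.2 (by nlinarith)
  have b1 := hT.bound _ hα1 _ hβ1 N
  have b2 := hT.bound _ hβ1 _ hα1 N
  -- This is the `1 / 6` in `7 / 6`; the remaining `1` is the rounding error.
  have hhalf := nearestDist_le_half B N
  have hround : |((⌈β * B⌉₊ : ℝ) - ⌈α * B⌉₊) * N / B - (β - α) * N| ≤ 1 := by
    have e : ((⌈β * B⌉₊ : ℝ) - ⌈α * B⌉₊) * N / B - (β - α) * N =
        ((⌈β * B⌉₊ - β * B) - (⌈α * B⌉₊ - α * B)) * (N / B) := by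
      field_simp
      ring
    have h2 : (N : ℝ) / B ≤ 1 := div_le_one_of_le₀ hNB hB.le
    rw [e, abs_mul, abs_of_nonneg (show 0 ≤ (N : ℝ) / B by positivity)]
    refine mul_le_one₀ ?_ (by positivity) h2
    rw [abs_le]
    constructor <;> linarith
  have e : localDiscrepancy α β N X = (initialDisc B T ⌈β * B⌉₊ N - initialDisc B T ⌈α * B⌉₊ N) +
      (((⌈β * B⌉₊ : ℝ) - ⌈α * B⌉₊) * N / B - (β - α) * N) := by
    rw [localDiscrepancy, countIn_eq_of_radicalInverse hT.toIsRadicalInverse hX hαβ]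
    unfold initialDisc
    ring
  rw [abs_le] at hround ⊢
  rw [e]
  constructor <;> linarith [hround.1, hround.2]

/-- The least power of `b` exceeding `N` is at most `b * N`, which costs an extra `log₂ b / 3`. -/
theorem extremeDiscrepancy_vdC_le {b : ℕ} [NeZero b] (hb : 1 < b) {σ : Equiv.Perm (Fin b)}
    (h0 : permFun σ 0 = 0) (hσ : PreservesBinaryBound b (permFun σ)) {N : ℕ} (hN : 0 < N) :
    extremeDiscrepancy N (vdC b σ) ≤ Real.logb 2 N / 3 + (Real.logb 2 b / 3 + 7 / 6) := by
  have hlt := Nat.lt_pow_succ_log_self hb N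
  have hle := Nat.pow_log_le_self b hN.ne'
  have hbpos : (0 : ℝ) < b := by positivity
  refine csSup_le ⟨_, 0, 1, le_rfl, one_pos, le_rfl, rfl⟩ ?_
  rintro d ⟨α, β, hα, hαβ, hβ, rfl⟩
  have key := abs_localDiscrepancy_le (X := vdC b σ) (N := N)
    (hasBinaryBound_radicalInverse hσ (Nat.log b N).succ)
    (fun i hi => vdC_eq_radicalInverse h0 (hi.trans hlt)) hlt.le hα hαβ.le hβ
  have hlog : Real.logb 2 ((b ^ (Nat.log b N).succ : ℕ) : ℝ) ≤ Real.logb 2 N + Real.logb 2 b := by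
    rw [Nat.pow_succ, Nat.cast_mul, Real.logb_mul (by positivity) hbpos.ne']
    gcongr
    · norm_num
  linarith

theorem asymptoticConstant_vdC_le {b : ℕ} [NeZero b] (hb : 1 < b) {σ : Equiv.Perm (Fin b)}
    (h0 : permFun σ 0 = 0) (hσ : PreservesBinaryBound b (permFun σ)) :
    asymptoticConstant (vdC b σ) ≤ ((1 / (3 * Real.log 2) : ℝ) : EReal) := by
  set C : ℝ := Real.logb 2 b / 3 + 7 / 6
  have hlog2 : 0 < Real.log 2 := Real.log_pos one_lt_two
  have hlog : Tendsto (fun N : ℕ => Real.log N) atTop atTop :=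
    Real.tendsto_log_atTop.comp tendsto_natCast_atTop_atTop
  have hlim : Tendsto (fun N : ℕ => ((1 / (3 * Real.log 2) + C / Real.log N : ℝ) : EReal)) atTop
      (nhds ((1 / (3 * Real.log 2) : ℝ) : EReal)) := by
    refine (continuous_coe_real_ereal.tendsto _).comp ?_
    simpa using tendsto_const_nhds.add (hlog.const_div_atTop C)
  rw [asymptoticConstant, ← hlim.limsup_eq]
  refine limsup_le_limsup ?_
  filter_upwards [eventually_gt_atTop 1] with N hN
  have hNlog : 0 < Real.log N := Real.log_pos (by exact_mod_cast hN)
  refine EReal.coe_le_coe_iff.2 ?_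
  rw [div_le_iff₀ hNlog]
  refine (extremeDiscrepancy_vdC_le hb h0 hσ (by omega)).trans (le_of_eq ?_)
  simp only [C, Real.logb]
  field_simp

/-! ### The lower bound in base `2` -/

/-- Some interval attains the upper estimate for the discrepancy in base `2`. -/
theorem exists_initialDisc_radicalInverse_two (N n : ℕ) :
    ∃ l, 0 < l ∧ l < 2 ^ (n + 1) ∧ initialDisc (2 ^ (n + 1)) (radicalInverse 2 id (n + 1)) l N =
      ∑ j ∈ Finset.range (n + 1), nearestDist (2 ^ (j + 1)) N := by
  have hT : ∀ n, IsRadicalInverse (2 ^ n) (radicalInverse 2 id n) := fun n =>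
    (hasBinaryBound_radicalInverse preservesBinaryBound_two n).toIsRadicalInverse
  have step : ∀ n u, u < 2 ^ n → initialDisc (2 ^ (n + 1)) (radicalInverse 2 id (n + 1))
      (2 * u + 1) N = initialDisc (2 ^ n) (radicalInverse 2 id n)
        (if N / 2 ^ n % 2 < 1 then u + 1 else u) N + nearestDist (2 ^ (n + 1)) N := by
    intro n u hu
    have hpos : (0 : ℝ) < (2 ^ n : ℕ) := by positivity
    have h2 : N / 2 ^ n % 2 < 2 := Nat.mod_lt _ two_pos
    have key := initialDisc_addDigit (hT n) two_pos bijOn_id_two hu one_le_two N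
    rw [← digitDisc_mod two_pos bijOn_id_two one_le_two, digitDisc_two_one h2 (by positivity)
      (div_le_one_of_le₀ (by exact_mod_cast (Nat.mod_lt N (by positivity)).le) hpos.le)] at key
    have hd := nearestDist_mul (b := 2) two_pos (hT n).pos N
    rw [Nat.cast_two] at hd
    rw [← hd] at key
    exact key
  induction n with
  | zero =>
    refine ⟨1, one_pos, by norm_num, ?_⟩
    have h := step 0 0 (by norm_num)
    rw [mul_zero, zero_add] at h
    rw [h]
    have hz : ∀ l ≤ 1, initialDisc (2 ^ 0) (radicalInverse 2 id 0) l N = 0 := by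
      intro l hl
      interval_cases l <;> simp [initialDisc, radicalInverse]
    rw [hz _ (by split_ifs <;> omega)]
    simp
  | succ n ih =>
    obtain ⟨l, hl0, hl, e⟩ := ih
    rw [Finset.sum_range_succ, ← e]
    -- The next end point is the odd neighbour `2 * l - 1` or `2 * l + 1`, chosen so that the
    -- recursion leads back to `l`; the strict bounds on `l` keep both choices admissible.
    by_cases h : N / 2 ^ (n + 1) % 2 < 1
    · refine ⟨2 * (l - 1) + 1, by omega, by rw [pow_succ]; omega, ?_⟩
      rw [step (n + 1) (l - 1) (by omega), if_pos h, Nat.sub_add_cancel hl0]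
    · refine ⟨2 * l + 1, by omega, by rw [pow_succ]; omega, ?_⟩
      rw [step (n + 1) l hl, if_neg h]

theorem radicalInverse_congr {b : ℕ} (hb : 0 < b) {s s' : ℕ → ℕ} (h : ∀ a < b, s a = s' a)
    (n : ℕ) : radicalInverse b s n = radicalInverse b s' n := by
  induction n with
  | zero => rfl
  | succ n ih => rw [radicalInverse, radicalInverse, ih, addDigit_congr hb h]

theorem permFun_refl_two : ∀ a < 2, id a = permFun (Equiv.refl (Fin 2)) a := by
  decide

theorem sum_nearestDist_le_extremeDiscrepancy {N n : ℕ} (hN : N ≤ 2 ^ (n + 1)) :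
    ∑ j ∈ Finset.range (n + 1), nearestDist (2 ^ (j + 1)) N ≤
      extremeDiscrepancy N (vdC 2 (Equiv.refl (Fin 2))) := by
  obtain ⟨l, hl0, hl, e⟩ := exists_initialDisc_radicalInverse_two N n
  rw [← e]
  have hT := hasBinaryBound_radicalInverse preservesBinaryBound_two (n + 1)
  have hX : ∀ i < N, vdC 2 (Equiv.refl (Fin 2)) i =
      radicalInverse 2 id (n + 1) i / ((2 ^ (n + 1) : ℕ) : ℝ) := by
    intro i hi
    rw [radicalInverse_congr two_pos permFun_refl_two]
    exact vdC_eq_radicalInverse (permFun_refl_two 0 two_pos).symm (hi.trans_le hN)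
  have hB : (0 : ℝ) < (2 ^ (n + 1) : ℕ) := by positivity
  have hlR : (0 : ℝ) < l := by exact_mod_cast hl0
  have hl1 : (l : ℝ) / (2 ^ (n + 1) : ℕ) ≤ 1 :=
    div_le_one_of_le₀ (by exact_mod_cast hl.le) hB.le
  have hlB : (0 : ℝ) < (l : ℝ) / (2 ^ (n + 1) : ℕ) := by positivity
  refine le_trans (le_of_eq_of_le ?_ (le_abs_self _))
    (le_csSup (bddAbove_discrepancy _ _) ⟨0, _, le_rfl, hlB, hl1, rfl⟩)
  rw [localDiscrepancy, countIn_eq_of_radicalInverse hT.toIsRadicalInverse hX hlB.le,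
    div_mul_cancel₀ _ hB.ne']
  simp only [initialDisc, Nat.ceil_natCast, zero_mul, Nat.ceil_zero, not_lt_zero, sub_zero,
    Nat.count_false, Nat.cast_zero]
  ring

/-- Since `N / B = P / 3 - 1 / (3 * B)` and `3 ∤ P`, the fractional part lies just below `1 / 3` or
`2 / 3`. -/
theorem one_third_sub_le_nearestDist {B N P : ℕ} (hB : 0 < B) (h : 3 * N + 1 = B * P) :
    1 / 3 - 1 / (3 * B) ≤ nearestDist B N := by
  have hBpos : (0 : ℝ) < B := by exact_mod_cast hB
  have hN := Nat.div_add_mod N B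
  have hr := Nat.mod_lt N hB
  unfold nearestDist
  set q := N / B
  set r := N % B
  have h1 : 3 * r + 1 = B * (P - 3 * q) := by
    rw [Nat.mul_sub, ← h, ← hN]
    have : B * (3 * q) = 3 * (B * q) := by ring
    omega
  have h2 : P - 3 * q < 3 := by
    by_contra! hc
    nlinarith
  have h3 : (3 * r + 1 : ℝ) = B * (P - 3 * q : ℕ) := by exact_mod_cast h1
  have h4 : (r : ℝ) / B = (P - 3 * q : ℕ) / 3 - 1 / (3 * B) := by
    field_simp
    linarith
  have h5 : (0 : ℝ) < 1 / (3 * B) := by positivity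
  rw [h4]
  generalize P - 3 * q = e at *
  interval_cases e
  · omega
  · refine le_min ?_ ?_ <;> push_cast <;> linarith
  · refine le_min ?_ ?_ <;> push_cast <;> linarith

/-- The losses `1 / (3 * 2 ^ (j + 1))` form a geometric series of sum less than `1 / 3`, so `n + 1`
digits give at least `n / 3`. -/
theorem le_extremeDiscrepancy_two {N n : ℕ} (h : 3 * N + 1 = 2 ^ (n + 1)) :
    (n : ℝ) / 3 ≤ extremeDiscrepancy N (vdC 2 (Equiv.refl (Fin 2))) := by
  refine le_trans ?_ (sum_nearestDist_le_extremeDiscrepancy (N := N) (n := n) (by omega))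
  have hsum : ∀ k, ∑ j ∈ Finset.range k, (1 / 3 - 1 / (3 * ((2 ^ (j + 1) : ℕ) : ℝ))) =
      (k : ℝ) / 3 - 1 / 3 + 1 / (3 * 2 ^ k) := by
    intro k
    induction k with
    | zero => norm_num
    | succ k ih =>
      rw [Finset.sum_range_succ, ih]
      push_cast
      rw [pow_succ]
      field_simp
      ring
  have hle : ∑ j ∈ Finset.range (n + 1), (1 / 3 - 1 / (3 * ((2 ^ (j + 1) : ℕ) : ℝ))) ≤
      ∑ j ∈ Finset.range (n + 1), nearestDist (2 ^ (j + 1)) N := by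
    refine Finset.sum_le_sum fun j hj => ?_
    have hj' : j < n + 1 := by simpa using hj
    refine one_third_sub_le_nearestDist (P := 2 ^ (n - j)) (by positivity) ?_
    rw [h, ← pow_add]
    congr 1
    omega
  rw [hsum] at hle
  refine le_trans ?_ hle
  have : (0 : ℝ) < 1 / (3 * 2 ^ (n + 1)) := by positivity
  push_cast
  linarith

theorem le_asymptoticConstant_vdC_two :
    ((1 / (3 * Real.log 2) : ℝ) : EReal) ≤
      asymptoticConstant (vdC 2 (Equiv.refl (Fin 2))) := by
  have hlog2 : 0 < Real.log 2 := Real.log_pos one_lt_two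
  -- Powers of `4` are `1` modulo `3`, so the division is exact; the shift `k + 2` keeps `φ k > 1`,
  -- so its logarithm is positive.
  set φ : ℕ → ℕ := fun k => (4 ^ (k + 2) - 1) / 3
  have hφ : ∀ k, 3 * φ k + 1 = 2 ^ (2 * k + 3 + 1) := by
    intro k
    have h4 : 4 ^ (k + 2) % 3 = 1 := by
      rw [Nat.pow_mod]
      simp
    rw [show 2 * k + 3 + 1 = 2 * (k + 2) by ring, pow_mul]
    have : 0 < 4 ^ (k + 2) := by positivity
    simp only [φ]
    norm_num
    omega
  have hφk : ∀ k, k < φ k := by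
    intro k
    have h1 := hφ k
    have h2 : 2 * k + 3 < 2 ^ (2 * k + 3) := Nat.lt_two_pow_self
    rw [pow_succ] at h1
    omega
  have hφ1 : ∀ k, 1 < φ k := by
    intro k
    have h1 := hφ k
    have h2 : 2 ^ 4 ≤ 2 ^ (2 * k + 3 + 1) := Nat.pow_le_pow_right two_pos (by omega)
    omega
  have hφtop : Tendsto φ atTop atTop :=
    tendsto_atTop_mono (fun k => (hφk k).le) tendsto_id
  have hlim : Tendsto (fun k : ℕ => ((1 / (3 * Real.log 2) -
      1 / (3 * Real.log 2) / ((2 * k + 4 : ℕ) : ℝ) : ℝ) : EReal)) atTop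
      (nhds ((1 / (3 * Real.log 2) : ℝ) : EReal)) := by
    refine (continuous_coe_real_ereal.tendsto _).comp ?_
    have hk : Tendsto (fun k : ℕ => ((2 * k + 4 : ℕ) : ℝ)) atTop atTop :=
      tendsto_natCast_atTop_atTop.comp (tendsto_atTop_mono (fun k => by simp; omega) tendsto_id)
    simpa using tendsto_const_nhds.sub (hk.const_div_atTop (1 / (3 * Real.log 2)))
  have hsub := limsup_le_limsup_of_le hφtop (u := fun N : ℕ =>
    ((extremeDiscrepancy N (vdC 2 (Equiv.refl (Fin 2))) / Real.log N : ℝ) : EReal))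
  refine le_trans ?_ hsub
  rw [← hlim.limsup_eq]
  refine limsup_le_limsup (Eventually.of_forall fun k => EReal.coe_le_coe_iff.2 ?_)
  have hpos : 0 < Real.log (φ k) := Real.log_pos (by exact_mod_cast hφ1 k)
  have hN : (φ k : ℝ) ≤ 2 ^ (2 * k + 4) := by
    have : φ k ≤ 2 ^ (2 * k + 3 + 1) := by rw [← hφ k]; omega
    exact_mod_cast this
  have hlogle : Real.log (φ k) ≤ (2 * k + 4 : ℕ) * Real.log 2 := by
    rw [← Real.log_pow]
    exact Real.log_le_log (by have := hφ1 k; positivity) hN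
  have hD := le_extremeDiscrepancy_two (hφ k)
  calc 1 / (3 * Real.log 2) - 1 / (3 * Real.log 2) / ((2 * k + 4 : ℕ) : ℝ)
      = ((2 * k + 3 : ℕ) : ℝ) / 3 / ((2 * k + 4 : ℕ) * Real.log 2) := by
        have : (0 : ℝ) < ((2 * k + 4 : ℕ) : ℝ) := by positivity
        push_cast at *
        field_simp
        ring
    _ ≤ ((2 * k + 3 : ℕ) : ℝ) / 3 / Real.log (φ k) := by gcongr
    _ ≤ _ := by gcongr

end VanDerCorput

theorem theorem3 :
    (∀ m : ℕ,
      VanDerCorput.asymptoticConstant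
          (VanDerCorput.vdC (9 * 2 ^ m) (VanDerCorput.faurePerm (9 * 2 ^ m))) ≤
        ((1 / (3 * Real.log 2) : ℝ) : EReal)) ∧
    ((1 / (3 * Real.log 2) : ℝ) : EReal) =
      VanDerCorput.asymptoticConstant (VanDerCorput.vdC 2 (Equiv.refl (Fin 2))) := by
  refine ⟨fun m => ?_, le_antisymm VanDerCorput.le_asymptoticConstant_vdC_two ?_⟩
  · have h := VanDerCorput.preservesBinaryBound_faurePerm m
    have hm : 0 < 2 ^ m := by positivity
    exact VanDerCorput.asymptoticConstant_vdC_le (by omega) h.2 h.1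
  · exact VanDerCorput.asymptoticConstant_vdC_le one_lt_two
      (VanDerCorput.permFun_refl_two 0 two_pos).symm
      (VanDerCorput.preservesBinaryBound_two.congr two_pos VanDerCorput.permFun_refl_two)
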